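/- Let $G$ be a connected graph with countably infinite vertex set $V$, and let $d$ be the edge-path distance on $V$. Suppose that $(V,d)$ is a quasi-tree, i.e. there are a tree $T$ (a connected graph without cycles, not necessarily locally finite) with its edge-path distance $d_T$ on its vertex set $W$, a map $g:V\to W$, and constants $A\ge 1$, $C>0$ such that $$\tfrac1A\,d(x,y)-A\le d_T(g(x),g(y))\le A\,d(x,y)+A\qquad\text{for all }x,y\in V,$$ and every ball of radius $C$ in $W$ meets $g(V)$. Let $o\in V$, let $\operatorname{Lip}_o(V)$ be the space of all Lipschitz functions $f:V\to\mathbb R$ with $f(o)=0$, normed by the best Lipschitz constant, and let the Lipschitz free space $\mathcal F(V)$ be the closed linear span of the evaluation functionals $\delta_x:f\mapsto f(x)$ $(x\in V)$ in the dual Banach space $\operatorname{Lip}_o(V)^*$. Then $\mathcal F(V)$ is isomorphic to $\ell^1$ as a Banach space: there is a bounded linear bijection $\mathcal F(V)\to\ell^1$ with bounded inverse, where $\ell^1$ is the space of absolutely summable real sequences. The graph $G$ is not assumed to be locally finite. -/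

import Mathlib

universe u v

namespace LipFree

/-! ### Quasi-isometries and quasi-trees -/

/-- Quasi-isometric embeddings: `A⁻¹ d(x, y) - A ≤ d(g x, g y) ≤ A d(x, y) + A` for some `A ≥ 1`. -/
def IsQuasiIsometricEmbedding {X Y : Type*} [MetricSpace X] [MetricSpace Y] (g : X → Y) : Prop :=
  ∃ A : ℝ, 1 ≤ A ∧ ∀ x₁ x₂ : X,
    (1 / A) * dist x₁ x₂ - A ≤ dist (g x₁) (g x₂) ∧ dist (g x₁) (g x₂) ≤ A * dist x₁ x₂ + A

/-- Quasi-isometries: quasi-isometric embeddings `g : X → Y` such that, for some `C > 0`, every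
ball of radius `C` in `Y` meets the image of `g`. -/
def IsQuasiIsometry {X Y : Type*} [MetricSpace X] [MetricSpace Y] (g : X → Y) : Prop :=
  IsQuasiIsometricEmbedding g ∧ ∃ C : ℝ, 0 < C ∧ ∀ y : Y, (Metric.ball y C ∩ Set.range g).Nonempty

/-- The edge-path metric on the vertex set of a connected graph. -/
noncomputable abbrev edgePathMetric {V : Type*} (G : SimpleGraph V) (hG : G.Connected) : MetricSpace V where
  dist x y := (G.dist x y : ℝ)
  dist_self x := by simp
  dist_comm x y := by rw [SimpleGraph.dist_comm]
  dist_triangle x y z := by exact_mod_cast hG.dist_triangle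
  eq_of_dist_eq_zero {x y} h := hG.dist_eq_zero_iff.1 (by exact_mod_cast h)

/-- A metric space is a quasi-tree if it is quasi-isometric to a tree, where a tree (a connected
graph without cycles, of arbitrary vertex degrees) carries its edge-path metric. -/
def IsQuasiTree (X : Type u) [MetricSpace X] : Prop :=
  ∃ (W : Type v) (T : SimpleGraph W) (hT : T.IsTree),
    letI : MetricSpace W := edgePathMetric T hT.connected
    ∃ g : X → W, IsQuasiIsometry g

/-! ### Lipschitz free spaces -/

section Lip

variable (X : Type u) [MetricSpace X] (o : X)

/-- The vector space of real-valued Lipschitz functions on `X` vanishing at `o`. -/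
def lipSubmodule : Submodule ℝ (X → ℝ) where
  carrier := {f | (∃ K : NNReal, LipschitzWith K f) ∧ f o = 0}
  zero_mem' := ⟨⟨0, LipschitzWith.const 0⟩, rfl⟩
  add_mem' := by
    rintro f g ⟨⟨K, hf⟩, hf0⟩ ⟨⟨L, hg⟩, hg0⟩
    exact ⟨⟨K + L, hf.add hg⟩, by simp [hf0, hg0]⟩
  smul_mem' := by
    rintro c f ⟨⟨K, hf⟩, hf0⟩
    exact ⟨⟨‖c‖₊ * K, (lipschitzWith_smul c).comp hf⟩, by simp [hf0]⟩

/-- `Lip_o(X)`. This is a type of its own, so that it does not inherit the topology of pointwise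
convergence; it is normed by the Lipschitz constant below. -/
def LipO : Type u := ↥(lipSubmodule X o)

instance : AddCommGroup (LipO X o) := inferInstanceAs (AddCommGroup ↥(lipSubmodule X o))

instance : Module ℝ (LipO X o) := inferInstanceAs (Module ℝ ↥(lipSubmodule X o))

variable {X o}

instance : CoeFun (LipO X o) (fun _ => X → ℝ) := ⟨fun f => f.1⟩

/-- The norm of `Lip_o(X)` is the best Lipschitz constant. -/
noncomputable instance : Norm (LipO X o) :=
  ⟨fun f => sInf {L : ℝ | 0 < L ∧ ∀ x y : X, |f x - f y| ≤ L * dist x y}⟩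

namespace LipO

theorem norm_def (f : LipO X o) :
    ‖f‖ = sInf {L : ℝ | 0 < L ∧ ∀ x y : X, |f x - f y| ≤ L * dist x y} := rfl

theorem add_apply (f g : LipO X o) (x : X) : (f + g) x = f x + g x := rfl

theorem smul_apply (c : ℝ) (f : LipO X o) (x : X) : (c • f) x = c * f x := rfl

theorem apply_base (f : LipO X o) : f o = 0 := f.2.2

theorem norm_nonneg' (f : LipO X o) : 0 ≤ ‖f‖ := Real.sInf_nonneg fun _ hL => hL.1.le

theorem norm_le (f : LipO X o) {L : ℝ} (hL : 0 ≤ L)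
    (h : ∀ x y : X, |f x - f y| ≤ L * dist x y) : ‖f‖ ≤ L := by
  refine le_of_forall_pos_le_add fun ε hε => ?_
  refine csInf_le ⟨0, fun _ hL => hL.1.le⟩ ⟨by linarith, fun x y => (h x y).trans ?_⟩
  exact mul_le_mul_of_nonneg_right (by linarith) dist_nonneg

theorem abs_sub_le (f : LipO X o) (x y : X) : |f x - f y| ≤ ‖f‖ * dist x y := by
  obtain ⟨K, hK⟩ := f.2.1
  rcases eq_or_lt_of_le (dist_nonneg (x := x) (y := y)) with h | h
  · have hxy : x = y := dist_eq_zero.1 h.symm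
    simp [hxy]
  · rw [← div_le_iff₀ h]
    refine le_csInf ⟨K + 1, by positivity, fun a b => ?_⟩ fun L hL => ?_
    · refine (hK.dist_le_mul a b).trans ?_
      exact mul_le_mul_of_nonneg_right (by linarith) dist_nonneg
    · rw [div_le_iff₀ h]
      exact hL.2 x y

theorem norm_add_le' (f g : LipO X o) : ‖f + g‖ ≤ ‖f‖ + ‖g‖ := by
  refine norm_le _ (add_nonneg f.norm_nonneg' g.norm_nonneg') fun x y => ?_
  rw [add_apply, add_apply, add_mul]
  calc |f x + g x - (f y + g y)| = |(f x - f y) + (g x - g y)| := by ring_nf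
    _ ≤ |f x - f y| + |g x - g y| := abs_add_le _ _
    _ ≤ _ := add_le_add (f.abs_sub_le x y) (g.abs_sub_le x y)

theorem norm_smul_le' (c : ℝ) (f : LipO X o) : ‖c • f‖ ≤ |c| * ‖f‖ := by
  refine norm_le _ (mul_nonneg (abs_nonneg c) f.norm_nonneg') fun x y => ?_
  rw [smul_apply, smul_apply, ← mul_sub, abs_mul, mul_assoc]
  exact mul_le_mul_of_nonneg_left (f.abs_sub_le x y) (abs_nonneg c)

theorem norm_core : NormedSpace.Core ℝ (LipO X o) where
  norm_nonneg := norm_nonneg'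
  norm_smul c f := by
    rw [Real.norm_eq_abs]
    refine le_antisymm (norm_smul_le' c f) ?_
    rcases eq_or_ne c 0 with rfl | hc
    · simpa using norm_nonneg' ((0 : ℝ) • f)
    · have h := norm_smul_le' c⁻¹ (c • f)
      rw [inv_smul_smul₀ hc, abs_inv] at h
      have hc' : 0 < |c| := abs_pos.2 hc
      calc |c| * ‖f‖ ≤ |c| * (|c|⁻¹ * ‖c • f‖) := mul_le_mul_of_nonneg_left h hc'.le
        _ = ‖c • f‖ := by rw [mul_inv_cancel_left₀ hc'.ne']
  norm_triangle := norm_add_le'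
  norm_eq_zero_iff f := by
    constructor
    · intro h
      refine Subtype.ext (funext fun x => ?_)
      have hx := f.abs_sub_le x o
      rw [h, zero_mul, f.apply_base, sub_zero] at hx
      exact abs_nonpos_iff.1 hx
    · rintro rfl
      refine le_antisymm (norm_le _ le_rfl fun x y => ?_) (norm_nonneg' _)
      have h0 : ∀ z : X, (0 : LipO X o) z = 0 := fun _ => rfl
      simp [h0]

end LipO

noncomputable instance : NormedAddCommGroup (LipO X o) := NormedAddCommGroup.ofCore LipO.norm_core

noncomputable instance : NormedSpace ℝ (LipO X o) := NormedSpace.ofCore LipO.norm_core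

variable (o)

/-- The evaluation functional `δ_x : f ↦ f x` in the dual Banach space of `Lip_o(X)`. -/
noncomputable def delta (x : X) : StrongDual ℝ (LipO X o) :=
  LinearMap.mkContinuous
    { toFun := fun f => f x
      map_add' := fun _ _ => rfl
      map_smul' := fun _ _ => rfl }
    (dist x o) (fun f => by
      have h := f.abs_sub_le x o
      rw [f.apply_base, sub_zero, mul_comm] at h
      exact h)

variable (X)

/-- The Lipschitz free space `ℱ(X)` of the pointed metric space `(X, o)`: the closed linear span of
the evaluation functionals in the dual of `Lip_o(X)`, with the dual norm. -/
noncomputable def LipschitzFreeSpace : Submodule ℝ (StrongDual ℝ (LipO X o)) :=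
  (Submodule.span ℝ (Set.range (delta o))).topologicalClosure

end Lip

end LipFree

namespace LipFree

/-! The free space of a rooted tree has the vectors `delta o x - delta o (p x)`, one for each edge
from a vertex `x` to its parent `p x`, as an `ℓ¹`-basis: real numbers can be prescribed freely as
increments along the edges, so a function with increments the signs of the coefficients norms any
combination. It therefore suffices to put a rooted tree on `V` itself that is bi-Lipschitz to `G`
(`nonempty_freeSpace_equiv_lp_one`).

To build it, group the vertices of each sphere about `o` that can be joined without entering the
smaller ball. Under a quasi-isometric embedding in a tree these classes have bounded diameter
(`exists_dist_le_of_levelRel`), and each class has a unique parent class one level down. Hanging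
each class from a chosen representative, and each representative from that of the parent class,
gives the tree (`exists_parent_map`). -/

/-- A function can be prescribed by its increments along a well-founded parent map. -/
theorem exists_eq_add_parent {X : Type*} (o : X) (p : X → X) (μ : X → ℕ)
    (hμ : ∀ x, x ≠ o → μ (p x) < μ x) (ε : X → ℝ) :
    ∃ f : X → ℝ, f o = 0 ∧ ∀ x, x ≠ o → f x = ε x + f (p x) := by
  classical
  let F : (x : X) → ((y : X) → μ y < μ x → ℝ) → ℝ :=
    fun x ih => if hx : x = o then 0 else ε x + ih (p x) (hμ x hx)
  have hwf : WellFounded (fun y x : X => μ y < μ x) := (measure μ).wf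
  refine ⟨hwf.fix F, ?_, fun x hx => ?_⟩
  · rw [hwf.fix_eq]; simp [F]
  · rw [hwf.fix_eq]; simp [F, hx]

/-! ### Operators on `ℓ¹` and the free space of a rooted tree -/

theorem lp_one_summable_abs (a : lp (fun _ : ℕ => ℝ) 1) : Summable fun n => |a n| := by
  have h := (memℓp_gen_iff (by norm_num)).1 (lp.memℓp a)
  simpa using h

theorem lp_one_norm_eq (a : lp (fun _ : ℕ => ℝ) 1) : ‖a‖ = ∑' n, |a n| := by
  have h := lp.norm_eq_tsum_rpow (by norm_num) a
  simpa using h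

/-- The operator `ℓ¹ → E`, `a ↦ ∑ aₙ vₙ`, attached to a bounded sequence `v`. -/
noncomputable def lpOneSum {E : Type*} [NormedAddCommGroup E] [NormedSpace ℝ E] [CompleteSpace E]
    (v : ℕ → E) (C : ℝ) (hv : ∀ n, ‖v n‖ ≤ C) : lp (fun _ : ℕ => ℝ) 1 →L[ℝ] E :=
  have hs (a : lp (fun _ : ℕ => ℝ) 1) : Summable fun n => ‖a n • v n‖ :=
    ((lp_one_summable_abs a).mul_right C).of_nonneg_of_le (fun _ => norm_nonneg _) fun n => by
      rw [norm_smul, Real.norm_eq_abs]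
      exact mul_le_mul_of_nonneg_left (hv n) (abs_nonneg _)
  LinearMap.mkContinuous
    { toFun := fun a => ∑' n, a n • v n
      map_add' := fun a b => by
        rw [← (hs a).of_norm.tsum_add (hs b).of_norm]
        exact tsum_congr fun n => by rw [← add_smul]; rfl
      map_smul' := fun c a => by
        rw [RingHom.id_apply, ← (hs a).of_norm.tsum_const_smul c]
        exact tsum_congr fun n => by rw [← mul_smul]; rfl }
    C fun a => by
      refine (norm_tsum_le_tsum_norm (hs a)).trans ?_
      rw [mul_comm, lp_one_norm_eq, ← tsum_mul_right]
      refine (hs a).tsum_le_tsum (fun n => ?_) ((lp_one_summable_abs a).mul_right C)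
      rw [norm_smul, Real.norm_eq_abs]
      exact mul_le_mul_of_nonneg_left (hv n) (abs_nonneg _)

section

variable {E : Type*} [NormedAddCommGroup E] [NormedSpace ℝ E] [CompleteSpace E]
  (v : ℕ → E) (C : ℝ) (hv : ∀ n, ‖v n‖ ≤ C)

theorem lpOneSum_hasSum (a : lp (fun _ : ℕ => ℝ) 1) :
    HasSum (fun n => a n • v n) (lpOneSum v C hv a) := by
  refine Summable.hasSum (Summable.of_norm ?_)
  refine ((lp_one_summable_abs a).mul_right C).of_nonneg_of_le (fun _ => norm_nonneg _) fun n => ?_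
  rw [norm_smul, Real.norm_eq_abs]
  exact mul_le_mul_of_nonneg_left (hv n) (abs_nonneg _)

theorem lpOneSum_single (n : ℕ) : lpOneSum v C hv (lp.single 1 n 1) = v n := by
  refine (lpOneSum_hasSum v C hv _).unique ?_
  convert hasSum_ite_eq n (v n) using 2 with m
  by_cases h : m = n
  · subst h; simp
  · simp [h]

end

theorem delta_apply {X : Type u} [MetricSpace X] (o x : X) (f : LipO X o) : delta o x f = f x := rfl

theorem norm_delta_sub_le {X : Type u} [MetricSpace X] (o x y : X) :
    ‖delta o x - delta o y‖ ≤ dist x y := by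
  refine ContinuousLinearMap.opNorm_le_bound _ dist_nonneg fun f => ?_
  rw [sub_apply, delta_apply, delta_apply, mul_comm]
  exact f.abs_sub_le x y

/-- If `p` is the parent map of a rooted tree on `X` such that parents are at bounded distance and
functions with bounded increments along the tree are Lipschitz, then `ℱ(X)` is isomorphic
to `ℓ¹`. -/
theorem nonempty_freeSpace_equiv_lp_one {X : Type u} [MetricSpace X] [Countable X] [Infinite X]
    (o : X) (p : X → X) (μ : X → ℕ) (hμ : ∀ x, x ≠ o → μ (p x) < μ x)
    (C : ℝ) (hC : ∀ x, x ≠ o → dist x (p x) ≤ C) (L : ℝ) (hL : 0 < L)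
    (hLip : ∀ f : X → ℝ, (∀ x, x ≠ o → |f x - f (p x)| ≤ 1) → ∀ x y, |f x - f y| ≤ L * dist x y) :
    Nonempty (LipschitzFreeSpace X o ≃L[ℝ] lp (fun _ : ℕ => ℝ) 1) := by
  classical
  have : Infinite {x : X // x ≠ o} := (Set.finite_singleton o).infinite_compl.to_subtype
  obtain ⟨e⟩ : Nonempty (ℕ ≃ {x : X // x ≠ o}) := nonempty_equiv_of_countable
  let w : ℕ → StrongDual ℝ (LipO X o) := fun n => delta o (e n : X) - delta o (p (e n))
  have hw (n : ℕ) : ‖w n‖ ≤ C := (norm_delta_sub_le o _ _).trans (hC _ (e n).2)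
  let S := lpOneSum w C hw
  have hlow (a : lp (fun _ : ℕ => ℝ) 1) : ‖a‖ ≤ L * ‖S a‖ := by
    obtain ⟨f, hf0, hf⟩ := exists_eq_add_parent o p μ hμ
      (fun x => if hx : x = o then 0 else (SignType.sign (a (e.symm ⟨x, hx⟩)) : ℝ))
    have hinc (x : X) (hx : x ≠ o) :
        f x - f (p x) = SignType.sign (a (e.symm ⟨x, hx⟩)) := by
      rw [hf x hx]; simp [hx]
    have hfL := hLip f fun x hx => by
      rw [hinc x hx]
      rcases lt_trichotomy (a (e.symm ⟨x, hx⟩)) 0 with h | h | h <;> simp [h]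
    let φ : LipO X o := ⟨f, ⟨L.toNNReal, LipschitzWith.of_dist_le_mul fun x y => by
      rw [Real.coe_toNNReal L hL.le]; exact hfL x y⟩, hf0⟩
    have hφ : ‖φ‖ ≤ L := LipO.norm_le φ hL.le hfL
    have hsum : S a φ = ‖a‖ := by
      rw [lp_one_norm_eq]
      have h1 := (lpOneSum_hasSum w C hw a).mapL
        (ContinuousLinearMap.apply ℝ ℝ φ)
      refine (h1.tsum_eq.symm.trans (tsum_congr fun n => ?_))
      have h2 : w n φ = SignType.sign (a n) := by
        have h3 := hinc (e n) (e n).2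
        rw [Subtype.coe_eta, Equiv.symm_apply_apply] at h3
        exact h3
      change a n * w n φ = |a n|
      rw [h2, self_mul_sign]
    calc ‖a‖ = S a φ := hsum.symm
      _ ≤ ‖S a‖ * ‖φ‖ := (le_abs_self _).trans ((S a).le_opNorm φ)
      _ ≤ L * ‖S a‖ := by
        rw [mul_comm]; exact mul_le_mul_of_nonneg_right hφ (norm_nonneg _)
  have hanti : AntilipschitzWith L.toNNReal S := S.antilipschitz_of_bound fun a => by
    rw [Real.coe_toNNReal L hL.le]; exact hlow a
  have hclosed : IsClosed (Set.range S) := hanti.isClosed_range S.uniformContinuous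
  -- Telescoping along the ancestors of `x` down to `o`, where `delta o o = 0`.
  have hdelta (x : X) : delta o x ∈ LinearMap.range S.toLinearMap := by
    induction h : μ x using Nat.strong_induction_on generalizing x with
    | _ n ih =>
      by_cases hx : x = o
      · have : delta o x = 0 := by
          ext f; rw [hx]; exact f.apply_base
        rw [this]; exact Submodule.zero_mem _
      · have h1 := ih _ (h ▸ hμ x hx) (p x) rfl
        have h2 : delta o x - delta o (p x) ∈ LinearMap.range S.toLinearMap :=
          ⟨lp.single 1 (e.symm ⟨x, hx⟩) 1, by
            change S _ = _
            rw [lpOneSum_single]; simp [w]⟩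
        simpa using Submodule.add_mem _ h2 h1
  have hrange : LinearMap.range S.toLinearMap = LipschitzFreeSpace X o := by
    apply le_antisymm
    · rintro _ ⟨a, rfl⟩
      have hsub (n : ℕ) : w n ∈ Submodule.span ℝ (Set.range (delta o)) :=
        Submodule.sub_mem _ (Submodule.subset_span ⟨_, rfl⟩) (Submodule.subset_span ⟨_, rfl⟩)
      refine mem_closure_of_tendsto (lpOneSum_hasSum w C hw a) (Filter.Eventually.of_forall ?_)
      exact fun s => Submodule.sum_mem _ fun n _ => Submodule.smul_mem _ _ (hsub n)
    · refine Submodule.topologicalClosure_minimal _ (Submodule.span_le.2 ?_) hclosed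
      rintro _ ⟨x, rfl⟩
      exact hdelta x
  exact ⟨((S.equivRange hanti.injective hclosed).trans
    (ContinuousLinearEquiv.ofEq _ _ hrange)).symm⟩

open SimpleGraph

/-! ### Level classes in quasi-trees -/

/-- In an acyclic graph, every vertex of a path lies on every walk with the same ends. -/
theorem support_subset_of_isPath {W : Type*} {T : SimpleGraph W} (hT : T.IsAcyclic) {a b : W}
    {P : T.Walk a b} (hP : P.IsPath) (Q : T.Walk a b) : P.support ⊆ Q.support := by
  classical
  have h : P = Q.bypass :=
    congrArg Subtype.val <| (hT.subsingleton_path a b).elim ⟨P, hP⟩ ⟨Q.bypass, Q.bypass_isPath⟩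
  rw [h]
  exact Q.support_bypass_subset_support

/-- A walk from `S₁` to `S₂` inside `S₁ ∪ S₂` has consecutive or equal vertices in `S₁`
and `S₂`. -/
theorem exists_dist_le_one_of_support_subset {W : Type*} {T : SimpleGraph W} {S₁ S₂ : Set W}
    {a b : W} (P : T.Walk a b) (ha : a ∈ S₁) (hb : b ∈ S₂)
    (hP : ∀ w ∈ P.support, w ∈ S₁ ∨ w ∈ S₂) :
    ∃ w ∈ P.support, ∃ w' ∈ S₂, w ∈ S₁ ∧ T.dist w w' ≤ 1 := by
  induction P with
  | nil => exact ⟨_, by simp, _, hb, ha, by simp⟩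
  | @cons a c b h P ih =>
    rcases hP c (by simp) with hc | hc
    · obtain ⟨w, hw, w', h'⟩ := ih hc hb fun w hw => hP w (by simp [hw])
      exact ⟨w, by simp [hw], w', h'⟩
    · exact ⟨a, by simp, c, hc, ha, (dist_eq_one_iff_adj.2 h).le⟩

/-- A map moving adjacent vertices by a bounded amount carries a walk to a walk, up to bounded
error. -/
theorem exists_walk_near_image {V W : Type*} {G : SimpleGraph V} {T : SimpleGraph W}
    (hT : T.Connected) (g : V → W) (B : ℕ) (hg : ∀ x y, G.Adj x y → T.dist (g x) (g y) ≤ B)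
    {x y : V} (P : G.Walk x y) :
    ∃ Q : T.Walk (g x) (g y), ∀ w ∈ Q.support, ∃ z ∈ P.support, T.dist (g z) w ≤ B := by
  classical
  induction P with
  | @nil u =>
    refine ⟨.nil, fun w hw => ⟨u, by simp, ?_⟩⟩
    obtain rfl : w = g u := by simpa using hw
    simp
  | @cons x c y h P ih =>
    obtain ⟨Q, hQ⟩ := ih
    obtain ⟨R, hR⟩ := hT.exists_walk_length_eq_dist (g x) (g c)
    refine ⟨R.append Q, fun w hw => ?_⟩
    rcases (Walk.mem_support_append_iff _ _).1 hw with hw | hw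
    · refine ⟨x, by simp, (dist_le (R.takeUntil w hw)).trans ?_⟩
      exact (R.length_takeUntil_le_length hw).trans (hR.trans_le (hg _ _ h))
    · obtain ⟨z, hz, h'⟩ := hQ w hw
      exact ⟨z, by simp [hz], h'⟩

theorem dist_add_dist_of_mem_support {V : Type*} {G : SimpleGraph V} {x y u : V}
    (P : G.Walk x y) (hP : P.length = G.dist x y) (hu : u ∈ P.support) :
    G.dist x u + G.dist u y ≤ G.dist x y := by
  classical
  have h := congrArg Walk.length (P.take_spec hu)
  rw [Walk.length_append] at h
  have h1 := dist_le (P.takeUntil u hu)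
  have h2 := dist_le (P.dropUntil u hu)
  omega

/-- Two vertices at the same distance `n` from `o` are equivalent if they are joined by a walk at
distance at least `n` from `o`. -/
def LevelRel {V : Type*} (G : SimpleGraph V) (o x y : V) : Prop :=
  G.dist o x = G.dist o y ∧ ∃ P : G.Walk x y, ∀ z ∈ P.support, G.dist o x ≤ G.dist o z

/-- The classes of `LevelRel` in a graph that embeds quasi-isometrically in a tree have bounded
diameter. -/
theorem exists_dist_le_of_levelRel {V W : Type*} {G : SimpleGraph V} (hG : G.Connected)
    {T : SimpleGraph W} (hT : T.IsTree) (g : V → W) (B K : ℕ)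
    (hg : ∀ x y, G.Adj x y → T.dist (g x) (g y) ≤ B)
    (hK : ∀ x y, T.dist (g x) (g y) ≤ 2 * B + 1 → G.dist x y ≤ K) (o : V) :
    ∀ x y, LevelRel G o x y → G.dist x y ≤ 4 * K := by
  classical
  rintro x y ⟨hxy, P, hP⟩
  obtain ⟨Px, hPx⟩ := hG.exists_walk_length_eq_dist x o
  obtain ⟨Py, hPy⟩ := hG.exists_walk_length_eq_dist o y
  obtain ⟨Q, hQ⟩ := exists_walk_near_image hT.connected g B hg P
  obtain ⟨Qx, hQx⟩ := exists_walk_near_image hT.connected g B hg Px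
  obtain ⟨Qy, hQy⟩ := exists_walk_near_image hT.connected g B hg Py
  -- The tree path from `g x` to `g y` is covered by the images of the two geodesics to `o`, so it
  -- passes from one to the other somewhere; it also stays near the image of `P`. Hence some `z` on
  -- `P` is `K`-close to both geodesics.
  obtain ⟨w, hw, w', hw'y, hwx, hww'⟩ :=
    exists_dist_le_one_of_support_subset (S₁ := {w | w ∈ Qx.support}) (S₂ := {w | w ∈ Qy.support})
      Q.bypass (by simp) (by simp) fun w hw => (Walk.mem_support_append_iff _ _).1
        (support_subset_of_isPath hT.isAcyclic Q.bypass_isPath (Qx.append Qy) hw)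
  obtain ⟨z, hz, hzw⟩ := hQ w (Q.support_bypass_subset_support hw)
  obtain ⟨s, hs, hsw⟩ := hQx w hwx
  obtain ⟨t, ht, htw⟩ := hQy w' hw'y
  have tri := fun a b c => hT.connected.dist_triangle (u := a) (v := b) (w := c)
  have triG := fun a b c => hG.dist_triangle (u := a) (v := b) (w := c)
  have hzs : G.dist z s ≤ K := hK _ _ (by
    have := tri (g z) w (g s); rw [T.dist_comm (u := w)] at this; omega)
  have hzt : G.dist z t ≤ K := hK _ _ (by
    have h1 := tri (g z) w (g t)
    have h2 := tri w w' (g t)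
    rw [T.dist_comm (u := w') (v := g t)] at h2; omega)
  -- Since `z` is no closer to `o` than `x`, the point `s` is at most `K` below the level of `x`. So
  -- `x` is within `K` of `s` and `2 * K` of `z`; likewise for `y`.
  have h1 := dist_add_dist_of_mem_support Px hPx hs
  have h2 := dist_add_dist_of_mem_support Py hPy ht
  have h3 := hP z hz
  have h4 := triG o s z
  have h5 := triG o t z
  have h6 := triG x s z
  have h7 := triG x z y
  have h8 := triG z t y
  rw [G.dist_comm (u := x) (v := o), G.dist_comm (u := s) (v := o)] at h1
  rw [G.dist_comm (u := s) (v := z)] at h4 h6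
  rw [G.dist_comm (u := t) (v := z)] at h5
  omega

/-! ### The rooted tree on the vertices -/

section

variable {V : Type*} {G : SimpleGraph V} {o : V}

theorem LevelRel.refl (x : V) : LevelRel G o x x := ⟨rfl, .nil, by simp⟩

theorem LevelRel.symm {x y : V} (h : LevelRel G o x y) : LevelRel G o y x := by
  obtain ⟨h, P, hP⟩ := h
  exact ⟨h.symm, P.reverse, fun z hz => h ▸ hP z (by simpa using hz)⟩

theorem LevelRel.trans {x y z : V} (h : LevelRel G o x y) (h' : LevelRel G o y z) :
    LevelRel G o x z := by
  obtain ⟨h, P, hP⟩ := h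
  obtain ⟨h', Q, hQ⟩ := h'
  refine ⟨h.trans h', P.append Q, fun w hw => ?_⟩
  rcases (Walk.mem_support_append_iff _ _).1 hw with hw | hw
  · exact hP w hw
  · exact h ▸ hQ w hw

theorem LevelRel.of_adj {x y : V} (h : G.Adj x y) (hxy : G.dist o x = G.dist o y) :
    LevelRel G o x y :=
  ⟨hxy, .cons h .nil, fun z hz => by
    rcases (by simpa using hz : z = x ∨ z = y) with rfl | rfl
    exacts [le_rfl, hxy.le]⟩

/-- Prolonging the walk by the two downward edges lowers its minimal level by just one. This makes
the parent class well defined. -/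
theorem LevelRel.parent {x y x' y' : V} (h : LevelRel G o x y) (hx : G.Adj x x')
    (hy : G.Adj y y') (hx' : G.dist o x' + 1 = G.dist o x) (hy' : G.dist o y' + 1 = G.dist o y) :
    LevelRel G o x' y' := by
  obtain ⟨h, P, hP⟩ := h
  refine ⟨by omega, .cons hx.symm (P.concat hy), fun z hz => ?_⟩
  rcases (by simpa [Walk.support_concat] using hz : z = x' ∨ z ∈ P.support ∨ z = y') with
    rfl | hz | rfl
  · exact le_rfl
  · have := hP z hz
    omega
  · omega

theorem exists_levelRel_representative (G : SimpleGraph V) (o : V) :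
    ∃ r : V → V, (∀ x, LevelRel G o x (r x)) ∧ ∀ x y, LevelRel G o x y → r x = r y := by
  let s : Setoid V := ⟨LevelRel G o, LevelRel.refl, LevelRel.symm, LevelRel.trans⟩
  exact ⟨fun x => (Quotient.mk s x).out, fun x => LevelRel.symm (Quotient.mk_out x),
    fun x y h => congrArg Quotient.out (Quotient.sound h)⟩

theorem exists_adj_dist_add_one (hG : G.Connected) {x : V} (hx : x ≠ o) :
    ∃ y, G.Adj x y ∧ G.dist o y + 1 = G.dist o x := by
  obtain ⟨P, hP⟩ := hG.exists_walk_length_eq_dist x o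
  cases P with
  | nil => exact absurd rfl hx
  | @cons _ y _ h P =>
    refine ⟨y, h, ?_⟩
    rw [Walk.length_cons, G.dist_comm] at hP
    have h1 := dist_le P
    have h2 := hG.dist_triangle (u := o) (v := y) (w := x)
    rw [dist_eq_one_iff_adj.2 h.symm] at h2
    rw [G.dist_comm] at h1
    omega

theorem abs_sub_le_of_adj (hG : G.Connected) (f : V → ℝ) (L : ℝ)
    (hf : ∀ x y, G.Adj x y → |f x - f y| ≤ L) (x y : V) : |f x - f y| ≤ L * G.dist x y := by
  obtain ⟨P, hP⟩ := hG.exists_walk_length_eq_dist x y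
  rw [← hP]
  clear hP
  induction P with
  | nil => simp
  | @cons x c y h P ih =>
    rw [Walk.length_cons]
    push_cast
    linarith [_root_.abs_sub_le (f x) (f c) (f y), hf _ _ h]

/-- A connected graph whose level classes have bounded diameter carries a rooted tree structure on
its vertices which is bi-Lipschitz equivalent to the edge-path metric. -/
theorem exists_parent_map (hG : G.Connected) (o : V) (D : ℕ)
    (hD : ∀ x y, LevelRel G o x y → G.dist x y ≤ D) :
    ∃ (p : V → V) (μ : V → ℕ), (∀ x, x ≠ o → μ (p x) < μ x) ∧
      (∀ x, x ≠ o → G.dist x (p x) ≤ D + 1) ∧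
      ∀ f : V → ℝ, (∀ x, x ≠ o → |f x - f (p x)| ≤ 1) →
        ∀ x y, |f x - f y| ≤ 3 * G.dist x y := by
  classical
  obtain ⟨r, hr, hr'⟩ := exists_levelRel_representative G o
  choose! q hq hq' using fun (x : V) (hx : x ≠ o) => exists_adj_dist_add_one hG hx
  have hrr (x : V) : r (r x) = r x := (hr' _ _ (hr x)).symm
  have hlev (x : V) : G.dist o (r x) = G.dist o x := (hr x).1.symm
  have hro : r o = o := by
    have h := hlev o
    rw [SimpleGraph.dist_self] at h
    exact (hG.dist_eq_zero_iff.1 h).symm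
  -- A vertex and its representative share a level, so the rank doubles the level and adds `1` off
  -- the representatives.
  refine ⟨fun x => if r x = x then r (q x) else r x,
    fun x => 2 * G.dist o x + if r x = x then 0 else 1, fun x hx => ?_, fun x hx => ?_,
    fun f hf => abs_sub_le_of_adj hG f 3 ?_⟩
  · by_cases h : r x = x
    · have := hq' x hx
      simp only [h, if_true, hrr, hlev]
      omega
    · simp [h, hrr, hlev]
  · by_cases h : r x = x
    · have h1 := hG.dist_triangle (u := x) (v := q x) (w := r (q x))
      have h2 := hD _ _ (hr (q x))
      rw [dist_eq_one_iff_adj.2 (hq x hx)] at h1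
      simp only [h, if_true]
      omega
    · simp only [h, if_false]
      exact (hD _ _ (hr x)).trans (Nat.le_succ D)
  · have hfr (x : V) : |f x - f (r x)| ≤ 1 := by
      by_cases h : r x = x
      · simp [h]
      · have hx : x ≠ o := by rintro rfl; exact h hro
        simpa [h] using hf x hx
    -- Three tree edges: `x` to `r x`, `r x` to its parent `r y`, and `r y` to `y`. An edge within a
    -- level needs only two.
    have hstep (x y : V) (h : G.Adj x y) (hxy : G.dist o y + 1 = G.dist o x) :
        |f x - f y| ≤ 3 := by
      have hrx : r x ≠ o := by
        intro h0
        have := hlev x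
        rw [h0, SimpleGraph.dist_self] at this
        omega
      have h1 := hf (r x) hrx
      have h2 : r (q (r x)) = r y :=
        hr' _ _ ((hr x).symm.parent (hq _ hrx) h (hq' _ hrx) hxy)
      simp only [hrr, if_true, h2] at h1
      have h3 := hfr x
      have h4 := hfr y
      rw [abs_le] at *
      constructor <;> linarith [h1.1, h1.2, h3.1, h3.2, h4.1, h4.2]
    intro x y h
    have h1 := hG.dist_triangle (u := o) (v := x) (w := y)
    have h2 := hG.dist_triangle (u := o) (v := y) (w := x)
    rw [dist_eq_one_iff_adj.2 h] at h1
    rw [dist_eq_one_iff_adj.2 h.symm] at h2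
    rcases (by omega : G.dist o x = G.dist o y ∨ G.dist o y + 1 = G.dist o x ∨
      G.dist o x + 1 = G.dist o y) with h3 | h3 | h3
    · have h4 := hfr x
      have h5 := hfr y
      rw [← hr' _ _ (LevelRel.of_adj h h3)] at h5
      rw [abs_le] at *
      constructor <;> linarith [h4.1, h4.2, h5.1, h5.2]
    · exact hstep x y h h3
    · rw [abs_sub_comm]
      exact hstep y x h.symm h3

end

end LipFree

theorem theorem1p1 {V : Type u} [Countable V] [Infinite V] (G : SimpleGraph V)
    (hG : G.Connected)
    (hqt : letI : MetricSpace V := LipFree.edgePathMetric G hG; LipFree.IsQuasiTree.{u, v} V)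
    (o : V) :
    letI : MetricSpace V := LipFree.edgePathMetric G hG
    Nonempty (LipFree.LipschitzFreeSpace V o ≃L[ℝ] lp (fun _ : ℕ => ℝ) 1) := by
  obtain ⟨W, T, hT, g, ⟨A, hA, hg⟩, -⟩ := hqt
  have hg' (x y : V) : 1 / A * (G.dist x y : ℝ) - A ≤ T.dist (g x) (g y) ∧
      (T.dist (g x) (g y) : ℝ) ≤ A * G.dist x y + A := hg x y
  have hA0 : 0 < A := by linarith
  -- Adjacent vertices have images at distance at most `A * 1 + A`, whence `B = ⌈2 * A⌉₊`; solving
  -- the lower bound for images at distance at most `2 * B + 1` gives `K`.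
  obtain ⟨p, μ, hμ, hp, hLip⟩ := LipFree.exists_parent_map hG o _
    (LipFree.exists_dist_le_of_levelRel hG hT g ⌈2 * A⌉₊ ⌈A * (2 * ⌈2 * A⌉₊ + 1 + A)⌉₊
      (fun x y h => by
        have h1 := (hg' x y).2
        rw [SimpleGraph.dist_eq_one_iff_adj.2 h, Nat.cast_one] at h1
        exact_mod_cast h1.trans ((by linarith : A * 1 + A ≤ 2 * A).trans (Nat.le_ceil _)))
      (fun x y h => by
        have h1 := (hg' x y).1
        have h2 : (T.dist (g x) (g y) : ℝ) ≤ 2 * ⌈2 * A⌉₊ + 1 := by exact_mod_cast h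
        have h3 : (G.dist x y : ℝ) / A ≤ 2 * ⌈2 * A⌉₊ + 1 + A := by
          rw [div_eq_mul_one_div, mul_comm]; linarith
        rw [div_le_iff₀ hA0, mul_comm] at h3
        exact_mod_cast h3.trans (Nat.le_ceil _)) o)
  let : MetricSpace V := LipFree.edgePathMetric G hG
  exact LipFree.nonempty_freeSpace_equiv_lp_one o p μ hμ _
    (fun x hx => Nat.cast_le.2 (hp x hx)) 3 (by norm_num) hLip
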